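/- Let $R$ be a commutative ring with identity, let $S \subseteq R$ be a multiplicative subset containing $1$ (zero-divisors are allowed), and let $R_S$ be the localization of $R$ at $S$. An $R$-module $C$ is called $S$-weakly cotorsion if $\operatorname{Ext}^1_R(R_S, C) = 0$, and an $R$-module $G$ is called $S$-strongly flat if $\operatorname{Ext}^1_R(G, C) = 0$ for every $S$-weakly cotorsion $R$-module $C$. A short exact sequence $0 \to A \to B \to C \to 0$ of $R$-modules, or more generally a finite exact sequence $0 \to C^0 \to C^1 \to \cdots \to C^{n+1} \to 0$, is called pure exact if it stays exact after tensoring over $R$ with every $R$-module. We say that $(\mathrm{OC})$ holds for $(R, S)$ if the projective dimension of $R_S$ as an $R$-module is at most $1$ and every flat $R$-module $F$, such that $F_S$ is a projective $R_S$-module and $F/sF$ is a projective $R/sR$-module for every $s \in S$, is $S$-strongly flat. (Conversely, if $F$ is $S$-strongly flat, then $F_S$ and all $F/sF$ are projective in this sense, for arbitrary $R$ and $S$.) Assume that $(\mathrm{OC})$ holds for $(R, S)$. Then: 1. If $M$ is an $R$-module that fits into a pure exact sequence $0 \to M \to G \to M \to 0$ with $G$ $S$-strongly flat, then $M$ is $S$-strongly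 flat. 2. If $n \geq 1$ and $M$ is an $R$-module that fits into a pure exact sequence $0 \to M \to G^1 \to G^2 \to \cdots \to G^n \to M \to 0$ with $G^i$ $S$-strongly flat for every $1 \leq i \leq n$, then $M$ is $S$-strongly flat. -/

import Mathlib

open CategoryTheory

universe u

namespace StronglyFlat

section Classes

variable {R : Type u} [CommRing R] (S : Submonoid R)

/-- `C` is `S`-weakly cotorsion: `Ext¹_R(R_S, C) = 0`. -/
def IsWeaklyCotorsion (C : Type u) [AddCommGroup C] [Module R C] : Prop :=
  Subsingleton
    (Abelian.Ext.{u} (ModuleCat.of R (Localization S)) (ModuleCat.of R C) 1)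

/-- `G` is `S`-strongly flat: `Ext¹_R(G, C) = 0` for every `S`-weakly cotorsion `C`. -/
def IsStronglyFlat (G : Type u) [AddCommGroup G] [Module R G] : Prop :=
  ∀ (C : Type u) [AddCommGroup C] [Module R C], IsWeaklyCotorsion S C →
    Subsingleton (Abelian.Ext.{u} (ModuleCat.of R G) (ModuleCat.of R C) 1)

/-- Condition (OC) for the pair `(R, S)`: the projective dimension of `R_S` over `R` is at most
one, and every flat `R`-module `F` such that `F_S` is projective over `R_S` and `F/sF` is
projective over `R/sR` for all `s ∈ S` is `S`-strongly flat. (The reverse implication, from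
strongly flat to the projectivity conditions, holds for all `R` and `S`, so it is not made a
part of the condition; requiring an equivalence here gives the same condition.) -/
def SatisfiesOC : Prop :=
  HasProjectiveDimensionLE (ModuleCat.of R (Localization S)) 1 ∧
    ∀ (F : Type u) [AddCommGroup F] [Module R F], Module.Flat R F →
      Module.Projective (Localization S) (LocalizedModule S F) →
      (∀ s ∈ S, Module.Projective (R ⧸ Ideal.span {s})
        (F ⧸ (Ideal.span {s} • (⊤ : Submodule R F)))) →
      IsStronglyFlat S F

end Classes

section Exactness

variable {R : Type u} [CommRing R]

/-- `0 → A → B → C → 0` is exact. -/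
structure IsShortExact {A B C : Type u} [AddCommGroup A] [AddCommGroup B] [AddCommGroup C]
    [Module R A] [Module R B] [Module R C] (f : A →ₗ[R] B) (g : B →ₗ[R] C) : Prop where
  injective : Function.Injective f
  exact : Function.Exact f g
  surjective : Function.Surjective g

/-- `0 → A → B → C → 0` is pure exact: it is exact and it stays exact after tensoring with any
`R`-module. -/
structure IsPureShortExact {A B C : Type u} [AddCommGroup A] [AddCommGroup B] [AddCommGroup C]
    [Module R A] [Module R B] [Module R C] (f : A →ₗ[R] B) (g : B →ₗ[R] C) : Prop where
  isShortExact : IsShortExact f g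
  tensor : ∀ (X : Type u) [AddCommGroup X] [Module R X],
    IsShortExact (f.lTensor X) (g.lTensor X)

/-- `0 → C 0 → C 1 → ⋯ → C n → C (n + 1) → 0` is exact. The modules and maps are given
as an infinite sequence, of which only the part up to `C (n + 1)` is used. -/
structure IsExactSeq (n : ℕ) {C : ℕ → Type u} [∀ i, AddCommGroup (C i)] [∀ i, Module R (C i)]
    (d : ∀ i, C i →ₗ[R] C (i + 1)) : Prop where
  injective : Function.Injective (d 0)
  exact : ∀ i < n, Function.Exact (d i) (d (i + 1))
  surjective : Function.Surjective (d n)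

/-- `0 → C 0 → C 1 → ⋯ → C n → C (n + 1) → 0` is pure exact: it is exact and it stays exact
after tensoring with any `R`-module. -/
structure IsPureExactSeq (n : ℕ) {C : ℕ → Type u} [∀ i, AddCommGroup (C i)]
    [∀ i, Module R (C i)] (d : ∀ i, C i →ₗ[R] C (i + 1)) : Prop where
  isExactSeq : IsExactSeq n d
  tensor : ∀ (X : Type u) [AddCommGroup X] [Module R X],
    IsExactSeq n (fun i => (d i).lTensor X)

end Exactness

end StronglyFlat

/-! By (OC) it suffices that M is flat and that its base changes to R_S and to all R/sR are
projective. Testing G against character modules shows that G is flat, so M, being pure in G, is flat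
too. The sequence therefore stays exact after base change to A = R_S or A = R/sR. Since every
A-module is S-weakly cotorsion, A ⊗ G is A-projective, and `projective_of_periodic` applies over A:
a flat module N with 0 → N → P → N → 0 exact and P projective is projective.

That theorem is proved by contracting the exact endomorphism d : P → N → P. Flat cycles give
contractions on finite sets, which suffice to extend a partial contraction by a finite set of
generators; a countable closure argument and Zorn's lemma then give a global one.

For long sequences, the cyclic sum of the short exact sequences of cycles is again periodic, and M
is a summand of the sum of the cycles. -/

/-! ### Flat periodic modules over projectives: contractions and the Benson–Goodearl theorem. -/

section Contraction

variable {A P : Type*} [CommRing A] [AddCommGroup P] [Module A P]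

/-- Purity of the cycles of an exact endomorphism, in its local splitting form. -/
theorem exists_fixing_of_flat_range [Module.Projective A P] (d : P →ₗ[A] P)
    (hd : Function.Exact d d) [Module.Flat A (LinearMap.range d)] (X : Finset P)
    (hX : ∀ x ∈ X, d x = 0) : ∃ σ : P →ₗ[A] P, ∀ x ∈ X, d (σ x) = x := by
  classical
  obtain ⟨i, hi⟩ := Module.projective_def'.mp ‹Module.Projective A P›
  have hi' : ∀ x, Finsupp.linearCombination A (id : P → P) (i x) = x := fun x ↦ congr($hi x)
  let T : Finset P := X.biUnion fun x ↦ (i x).support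
  let α : P →ₗ[A] (T → A) := LinearMap.pi fun t ↦ Finsupp.lapply (t : P) ∘ₗ i
  let ψ : (T → A) →ₗ[A] P := Fintype.linearCombination A (fun t : T ↦ (t : P))
  have hψ : ∀ x ∈ X, ψ (α x) = x := by
    intro x hx
    conv_rhs => rw [← hi' x]
    rw [Finsupp.linearCombination_apply, Finsupp.sum_of_support_subset (s := T) _
      (Finset.subset_biUnion_of_mem (fun x ↦ (i x).support) hx) _ (by simp)]
    simp only [ψ, α, Fintype.linearCombination_apply, LinearMap.pi_apply, LinearMap.comp_apply,
      Finsupp.lapply_apply, id]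
    exact Finset.sum_coe_sort T fun t ↦ (i x) t • t
  let κ : (X →₀ A) →ₗ[A] (T → A) := Finsupp.linearCombination A fun x : X ↦ α x
  have hκ : (d.rangeRestrict ∘ₗ ψ) ∘ₗ κ = 0 := by
    ext x
    simp [κ, hψ x x.2, hX x x.2]
  -- Equational criterion of flatness: `d ∘ ψ` factors through a finite free module by a map `a`
  -- that kills the relations `α x`, so subtracting `z ∘ a` from `ψ` does not affect its values
  -- there.
  obtain ⟨k, a, y, hya, ha⟩ := Module.Flat.exists_factorization_of_comp_eq_zero_of_free hκ
  obtain ⟨z, hz⟩ := Module.projective_lifting_property d.rangeRestrict y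
    (LinearMap.surjective_rangeRestrict d)
  have hker : ∀ v, ψ v - z (a v) ∈ LinearMap.range d := by
    intro v
    have h1 : d (ψ v) = d (z (a v)) := by
      have h2 := congr(($hya v : P))
      have h3 := congr(($hz (a v) : P))
      exact h2.trans h3.symm
    exact (hd _).mp (by rw [map_sub, h1, sub_self])
  obtain ⟨σ, hσ⟩ := Module.projective_lifting_property d.rangeRestrict
    (((ψ - z ∘ₗ a).codRestrict (LinearMap.range d) hker) ∘ₗ α)
    (LinearMap.surjective_rangeRestrict d)
  refine ⟨σ, fun x hx ↦ ?_⟩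
  have h4 := congr(($hσ x : P))
  have h5 : a (α x) = 0 := by
    have := congr($ha (Finsupp.single ⟨x, hx⟩ 1))
    simpa [κ] using this
  simpa [h5, hψ x hx] using h4

/-- `σ` splits `d` on the boundaries `d x`, so the error `e` of `σ` sends `X` to cycles and kills
these boundaries. A second splitting `ρ` on the errors then corrects `σ`. -/
theorem exists_local_contraction [Module.Projective A P] (d : P →ₗ[A] P)
    (hd : Function.Exact d d) [Module.Flat A (LinearMap.range d)] (X : Finset P) :
    ∃ r : P →ₗ[A] P, ∀ x ∈ X, d (r x) + r (d x) = x := by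
  classical
  have dd : ∀ x, d (d x) = 0 := fun x ↦ hd.apply_apply_eq_zero x
  obtain ⟨σ, hσ⟩ := exists_fixing_of_flat_range d hd (X.image d) (by simp [dd])
  let e : P →ₗ[A] P := LinearMap.id - d ∘ₗ σ - σ ∘ₗ d
  have he : ∀ x, e x = x - d (σ x) - σ (d x) := fun x ↦ rfl
  have hdx : ∀ x ∈ X, d (σ (d x)) = d x := fun x hx ↦ hσ _ (Finset.mem_image_of_mem d hx)
  obtain ⟨ρ, hρ⟩ := exists_fixing_of_flat_range d hd (X.image e) (by
    simp only [Finset.mem_image, forall_exists_index, and_imp, forall_apply_eq_imp_iff₂]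
    intro x hx
    simp [he, dd, hdx x hx])
  refine ⟨σ + ρ ∘ₗ e, fun x hx ↦ ?_⟩
  have h1 : e (d x) = 0 := by simp [he, dd, hdx x hx]
  have h2 := hρ _ (Finset.mem_image_of_mem e hx)
  simp only [LinearMap.add_apply, LinearMap.comp_apply, map_add, h1, h2, map_zero, add_zero]
  rw [he]
  abel

theorem Finsupp.linearCombination_congr_left {s t : P → P} {l : P →₀ A}
    (h : ∀ x ∈ l.support, s x = t x) :
    Finsupp.linearCombination A s l = Finsupp.linearCombination A t l := by
  simp only [Finsupp.linearCombination_apply]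
  exact Finsupp.sum_congr fun x hx ↦ by rw [h x hx]

/-- `s` is a contraction of `d` at the generators `x ∈ J` of `P`, where `i` is a section of the
canonical surjection onto `P` from the free module on `P`. -/
def IsContractionOn (d : P →ₗ[A] P) (i : P →ₗ[A] P →₀ A) (J : Set P) (s : P → P) : Prop :=
  ∀ x ∈ J, d (s x) + Finsupp.linearCombination A s (i (d x)) = x

/-- `J` contains the generators that occur in `i (d x)` for `x ∈ J`. -/
def IsClosedUnder (d : P →ₗ[A] P) (i : P →ₗ[A] P →₀ A) (J : Set P) : Prop :=
  ∀ x ∈ J, ∀ y ∈ (i (d x)).support, y ∈ J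

variable {d : P →ₗ[A] P} {i : P →ₗ[A] P →₀ A}

/-- The error `e` of `s` commutes with `d` in the sense of `hed`, so adding `r ∘ e`, with `r` a
local contraction at the finitely many errors on `B`, removes them. On `J` the error is zero and `s`
keeps its values. -/
theorem IsContractionOn.extend_finite (dd : ∀ x, d (d x) = 0)
    (hi : ∀ x, Finsupp.linearCombination A id (i x) = x)
    (hr : ∀ X : Finset P, ∃ r : P →ₗ[A] P, ∀ x ∈ X, d (r x) + r (d x) = x)
    {J : Set P} {s : P → P} (hs : IsContractionOn d i J s) (B : Finset P) :
    ∃ t : P → P, IsContractionOn d i (J ∪ B) t ∧ ∀ x ∈ J, t x = s x := by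
  classical
  let ℓ : (P →₀ A) →ₗ[A] P := Finsupp.linearCombination A s
  let p : (P →₀ A) →ₗ[A] P := Finsupp.linearCombination A id
  let e : (P →₀ A) →ₗ[A] P := p - d ∘ₗ ℓ - ℓ ∘ₗ i ∘ₗ d ∘ₗ p
  let b : P → (P →₀ A) := fun x ↦ Finsupp.single x 1
  have he : ∀ x, e (b x) = x - d (s x) - ℓ (i (d x)) := fun x ↦ by simp [e, p, ℓ, b]
  have hed : ∀ x, e (i (d x)) = d (e (b x)) := fun x ↦ by
    rw [he]
    simp [e, p, hi, dd]
  obtain ⟨r, hr⟩ := hr (B.image fun x ↦ e (b x))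
  have hlin : ∀ l, Finsupp.linearCombination A (fun x ↦ s x + r (e (b x))) l = ℓ l + r (e l) := by
    intro l
    have : Finsupp.linearCombination A (fun x ↦ s x + r (e (b x))) = ℓ + r ∘ₗ e := by
      ext x
      simp [ℓ, b]
    rw [this]
    rfl
  have h0 : ∀ x ∈ J, e (b x) = 0 := fun x hx ↦ by
    rw [he, sub_sub, hs x hx, sub_self]
  refine ⟨fun x ↦ s x + r (e (b x)), ?_, fun x hx ↦ by simp [h0 x hx]⟩
  intro x hx
  have key : d (r (e (b x))) + r (d (e (b x))) = e (b x) := by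
    rcases hx with hx | hx
    · simp [h0 x hx]
    · exact hr _ (Finset.mem_image_of_mem (fun x ↦ e (b x)) hx)
  rw [hlin, hed, map_add]
  calc d (s x) + d (r (e (b x))) + (ℓ (i (d x)) + r (d (e (b x))))
      = d (s x) + ℓ (i (d x)) + (d (r (e (b x))) + r (d (e (b x)))) := by abel
    _ = x := by rw [key, he]; abel

/-- Gluing functions that agree on the members of a directed family of subsets. -/
theorem exists_glued_function {α β κ : Type*} (J : κ → Set α) (s : κ → α → β) (s₀ : α → β)
    (h : ∀ k l x, x ∈ J k → x ∈ J l → s k x = s l x) :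
    ∃ t : α → β, ∀ k, ∀ x ∈ J k, t x = s k x := by
  classical
  refine ⟨fun x ↦ if hx : ∃ k, x ∈ J k then s hx.choose x else s₀ x, fun k x hx ↦ ?_⟩
  have hx' : ∃ k, x ∈ J k := ⟨k, hx⟩
  simp only [dif_pos hx']
  exact h _ _ _ hx'.choose_spec hx

/-- Closing up `{a}` may take countably many generators. They are added in finite batches `B n`, and
values once fixed on `K n` never change, so the stages glue. -/
theorem IsContractionOn.extend (dd : ∀ x, d (d x) = 0)
    (hi : ∀ x, Finsupp.linearCombination A id (i x) = x)
    (hr : ∀ X : Finset P, ∃ r : P →ₗ[A] P, ∀ x ∈ X, d (r x) + r (d x) = x)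
    {J : Set P} {s : P → P} (hJ : IsClosedUnder d i J) (hs : IsContractionOn d i J s) (a : P) :
    ∃ (J' : Set P) (t : P → P), IsClosedUnder d i J' ∧ IsContractionOn d i J' t ∧
      J ⊆ J' ∧ a ∈ J' ∧ ∀ x ∈ J, t x = s x := by
  classical
  let B : ℕ → Finset P := fun n ↦
    Nat.rec (motive := fun _ ↦ Finset P) {a} (fun _ C ↦ C ∪ C.biUnion fun x ↦ (i (d x)).support) n
  have hB : ∀ n, B (n + 1) = B n ∪ (B n).biUnion fun x ↦ (i (d x)).support := fun n ↦ rfl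
  let K : ℕ → Set P := fun n ↦ J ∪ (B n : Set P)
  have hKmono : Monotone K := monotone_nat_of_le_succ fun n ↦
    Set.union_subset_union_right _ (by rw [hB]; exact_mod_cast Finset.subset_union_left)
  have hKcl : ∀ n, ∀ x ∈ K n, ∀ y ∈ (i (d x)).support, y ∈ K (n + 1) := by
    intro n x hx y hy
    rcases hx with hx | hx
    · exact Or.inl (hJ x hx y hy)
    · refine Or.inr ?_
      rw [hB]
      exact Finset.mem_coe.mpr (Finset.mem_union_right _ (Finset.mem_biUnion.mpr ⟨x, hx, hy⟩))
  have step : ∀ n (t : {t : P → P // IsContractionOn d i (K n) t}),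
      ∃ t' : {t : P → P // IsContractionOn d i (K (n + 1)) t}, ∀ x ∈ K n, t'.1 x = t.1 x := by
    intro n t
    obtain ⟨t', h1, h2⟩ := t.2.extend_finite dd hi hr (B (n + 1))
    exact ⟨⟨t', fun x hx ↦ h1 x (hx.imp (fun h ↦ Or.inl h) id)⟩, h2⟩
  obtain ⟨t₀, ht₀, hst₀⟩ := hs.extend_finite dd hi hr (B 0)
  choose next hnext using step
  let T : ∀ n, {t : P → P // IsContractionOn d i (K n) t} := fun n ↦ Nat.rec ⟨t₀, ht₀⟩ next n
  have hT : ∀ n, ∀ x ∈ K n, (T (n + 1)).1 x = (T n).1 x := fun n ↦ hnext n (T n)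
  have hT' : ∀ n m, n ≤ m → ∀ x ∈ K n, (T m).1 x = (T n).1 x := by
    intro n m hnm
    induction m, hnm using Nat.le_induction with
    | base => exact fun _ _ ↦ rfl
    | succ m hm ih => exact fun x hx ↦ (hT m x (hKmono hm hx)).trans (ih x hx)
  obtain ⟨t, ht⟩ := exists_glued_function K (fun n ↦ (T n).1) id fun k l x hk hl ↦ by
    rcases le_total k l with h | h
    · exact (hT' k l h x hk).symm
    · exact hT' l k h x hl
  refine ⟨⋃ n, K n, t, ?_, ?_, fun x hx ↦ Set.mem_iUnion.mpr ⟨0, Or.inl hx⟩,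
    Set.mem_iUnion.mpr ⟨0, Or.inr (by simp [B])⟩, fun x hx ↦ ?_⟩
  · intro x hx y hy
    obtain ⟨n, hn⟩ := Set.mem_iUnion.mp hx
    exact Set.mem_iUnion.mpr ⟨n + 1, hKcl n x hn y hy⟩
  · intro x hx
    obtain ⟨n, hn⟩ := Set.mem_iUnion.mp hx
    have hn' := hKmono n.le_succ hn
    rw [ht (n + 1) x hn', Finsupp.linearCombination_congr_left fun y hy ↦
      ht (n + 1) y (hKcl n x hn y hy)]
    exact (T (n + 1)).2 x hn'
  · rw [ht 0 x (Or.inl hx)]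
    exact hst₀ x hx

theorem exists_contraction [Module.Projective A P] (dd : ∀ x, d (d x) = 0)
    (hr : ∀ X : Finset P, ∃ r : P →ₗ[A] P, ∀ x ∈ X, d (r x) + r (d x) = x) :
    ∃ s : P →ₗ[A] P, ∀ x, d (s x) + s (d x) = x := by
  classical
  obtain ⟨i, hi⟩ := Module.projective_def'.mp ‹Module.Projective A P›
  have hi' : ∀ x, Finsupp.linearCombination A (id : P → P) (i x) = x := fun x ↦ congr($hi x)
  -- Closedness makes the contraction identity on `J` depend only on the values of `s` on `J`, so it
  -- passes to unions of chains.
  let α := {q : Set P × (P → P) // IsClosedUnder d i q.1 ∧ IsContractionOn d i q.1 q.2}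
  obtain ⟨⟨⟨J, s⟩, hJ, hs⟩, hmax⟩ := exists_maximal_of_chains_bounded
    (r := fun q q' : α ↦ q.1.1 ⊆ q'.1.1 ∧ ∀ x ∈ q.1.1, q'.1.2 x = q.1.2 x) (by
      intro c hc
      obtain ⟨t, ht⟩ := exists_glued_function (fun q : c ↦ q.1.1.1) (fun q ↦ q.1.1.2) id
        fun k l x hk hl ↦ by
          rcases eq_or_ne k.1 l.1 with h | h
          · rw [h]
          · rcases hc k.2 l.2 h with h | h
            · exact (h.2 x hk).symm
            · exact h.2 x hl
      refine ⟨⟨⟨⋃ q : c, q.1.1.1, t⟩, ?_, ?_⟩, fun q hq ↦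
        ⟨Set.subset_iUnion (fun q : c ↦ q.1.1.1) ⟨q, hq⟩, ht ⟨q, hq⟩⟩⟩
      · intro x hx y hy
        obtain ⟨q, hq⟩ := Set.mem_iUnion.mp hx
        exact Set.mem_iUnion.mpr ⟨q, q.1.2.1 x hq y hy⟩
      · intro x hx
        obtain ⟨q, hq⟩ := Set.mem_iUnion.mp hx
        change d (t x) + Finsupp.linearCombination A t (i (d x)) = x
        rw [ht q x hq, Finsupp.linearCombination_congr_left fun y hy ↦
          ht q y (q.1.2.1 x hq y hy)]
        exact q.1.2.2 x hq)
    (fun {a b c} hab hbc ↦ ⟨hab.1.trans hbc.1, fun x hx ↦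
      (hbc.2 x (hab.1 hx)).trans (hab.2 x hx)⟩)
  have hJtop : ∀ x, x ∈ J := by
    intro x
    obtain ⟨J', t, h1, h2, h3, h4, h5⟩ := hs.extend dd hi' hr hJ x
    exact (hmax ⟨⟨J', t⟩, h1, h2⟩ ⟨h3, h5⟩).1 h4
  let ℓ : (P →₀ A) →ₗ[A] P := Finsupp.linearCombination A s
  have key : d ∘ₗ ℓ + ℓ ∘ₗ i ∘ₗ d ∘ₗ Finsupp.linearCombination A id =
      Finsupp.linearCombination A id := by
    ext x
    simpa [ℓ] using hs x (hJtop x)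
  refine ⟨ℓ ∘ₗ i, fun x ↦ ?_⟩
  have := congr($key (i x))
  simpa [hi'] using this

/-- The **Benson–Goodearl theorem**: flat cycles of an exact endomorphism of a projective module
are projective. -/
theorem projective_range_of_exact_of_flat [Module.Projective A P] (hd : Function.Exact d d)
    [Module.Flat A (LinearMap.range d)] : Module.Projective A (LinearMap.range d) := by
  have dd : ∀ x, d (d x) = 0 := fun x ↦ hd.apply_apply_eq_zero x
  obtain ⟨s, hs⟩ := exists_contraction dd (exists_local_contraction d hd)
  refine .of_split (s ∘ₗ (LinearMap.range d).subtype) d.rangeRestrict ?_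
  ext ⟨_, x, rfl⟩
  have := hs (d x)
  rw [dd, map_zero, add_zero] at this
  simpa using this

/-- The composite `f ∘ₗ g` is an exact endomorphism of `P` whose range is a copy of `N`. -/
theorem projective_of_periodic {N : Type*} [AddCommGroup N] [Module A N]
    [Module.Projective A P] [Module.Flat A N] {f : N →ₗ[A] P} {g : P →ₗ[A] N}
    (hf : Function.Injective f) (hfg : Function.Exact f g) (hg : Function.Surjective g) :
    Module.Projective A N := by
  have hrange : LinearMap.range (f ∘ₗ g) = LinearMap.range f :=
    LinearMap.range_comp_of_range_eq_top _ (LinearMap.range_eq_top.mpr hg)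
  let e : N ≃ₗ[A] LinearMap.range (f ∘ₗ g) :=
    (LinearEquiv.ofInjective f hf).trans (LinearEquiv.ofEq _ _ hrange.symm)
  have : Module.Flat A (LinearMap.range (f ∘ₗ g)) := .of_linearEquiv e.symm
  have hd : Function.Exact (f ∘ₗ g) (f ∘ₗ g) := by
    intro x
    rw [LinearMap.comp_apply, map_eq_zero_iff f hf, hfg x, LinearMap.coe_comp, hg.range_comp]
  have := projective_range_of_exact_of_flat hd
  exact .of_equiv e.symm

end Contraction

/-! ### Vanishing of Ext as an extension property. -/

section Ext

variable {R : Type u} [CommRing R] {K P G C : Type u} [AddCommGroup K] [AddCommGroup P]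
  [AddCommGroup G] [AddCommGroup C] [Module R K] [Module R P] [Module R G] [Module R C]

theorem ModuleCat.shortExact_of_exact {f : K →ₗ[R] P} {g : P →ₗ[R] G}
    (hf : Function.Injective f) (hfg : Function.Exact f g) (hg : Function.Surjective g) :
    (ShortComplex.mk (ModuleCat.ofHom f) (ModuleCat.ofHom g)
      (by ext x; exact hfg.apply_apply_eq_zero x)).ShortExact :=
  ModuleCat.shortComplex_shortExact _ hfg hf hg

theorem exists_extension_of_subsingleton_ext
    [Subsingleton (Abelian.Ext.{u} (ModuleCat.of R G) (ModuleCat.of R C) 1)]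
    {f : K →ₗ[R] P} {g : P →ₗ[R] G} (hf : Function.Injective f) (hfg : Function.Exact f g)
    (hg : Function.Surjective g) (φ : K →ₗ[R] C) : ∃ ψ : P →ₗ[R] C, ψ ∘ₗ f = φ := by
  obtain ⟨x, hx⟩ := Abelian.Ext.contravariant_sequence_exact₁
    (ModuleCat.shortExact_of_exact hf hfg hg) (ModuleCat.of R C)
    (Abelian.Ext.mk₀ (ModuleCat.ofHom φ)) (n₁ := 1) rfl
    (Subsingleton.elim (α := Abelian.Ext.{u} (ModuleCat.of R G) (ModuleCat.of R C) 1) _ _)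
  obtain ⟨ψ, rfl⟩ := (Abelian.Ext.mk₀_bijective _ _).2 x
  rw [Abelian.Ext.mk₀_comp_mk₀] at hx
  refine ⟨ψ.hom, ?_⟩
  have := (Abelian.Ext.mk₀_bijective _ _).1 hx
  exact congr(ModuleCat.Hom.hom $this)

theorem subsingleton_ext_of_exists_extension [Module.Projective R P]
    {f : K →ₗ[R] P} {g : P →ₗ[R] G} (hf : Function.Injective f) (hfg : Function.Exact f g)
    (hg : Function.Surjective g) (h : ∀ φ : K →ₗ[R] C, ∃ ψ : P →ₗ[R] C, ψ ∘ₗ f = φ) :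
    Subsingleton (Abelian.Ext.{u} (ModuleCat.of R G) (ModuleCat.of R C) 1) := by
  refine subsingleton_of_forall_eq 0 fun y ↦ ?_
  have : Projective (ModuleCat.of R P) := (IsProjective.iff_projective P).mp inferInstance
  have S := ModuleCat.shortExact_of_exact hf hfg hg
  obtain ⟨x, rfl⟩ := Abelian.Ext.contravariant_sequence_exact₃ S (ModuleCat.of R C) y
    (Abelian.Ext.eq_zero_of_projective (P := ModuleCat.of R P) _) (n₀ := 0) rfl
  obtain ⟨φ, rfl⟩ := (Abelian.Ext.mk₀_bijective _ _).2 x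
  obtain ⟨ψ, hψ⟩ := h φ.hom
  have : φ = ModuleCat.ofHom f ≫ ModuleCat.ofHom ψ := by
    ext x
    exact congr($hψ.symm x)
  rw [this, ← Abelian.Ext.mk₀_comp_mk₀]
  exact S.extClass_comp_assoc _

theorem subsingleton_ext_of_retract {n : ℕ} {H : Type u} [AddCommGroup H] [Module R H]
    [Subsingleton (Abelian.Ext.{u} (ModuleCat.of R G) (ModuleCat.of R C) n)]
    (i : H →ₗ[R] G) (r : G →ₗ[R] H) (h : r ∘ₗ i = LinearMap.id) :
    Subsingleton (Abelian.Ext.{u} (ModuleCat.of R H) (ModuleCat.of R C) n) := by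
  refine subsingleton_of_forall_eq 0 fun y ↦ ?_
  have h1 : ModuleCat.ofHom i ≫ ModuleCat.ofHom r = 𝟙 (ModuleCat.of R H) := by
    ext x
    exact congr($h x)
  rw [← Abelian.Ext.mk₀_id_comp y, ← h1, ← Abelian.Ext.mk₀_comp_mk₀_assoc,
    Subsingleton.elim ((Abelian.Ext.mk₀ (ModuleCat.ofHom r)).comp y (zero_add n)) 0,
    Abelian.Ext.comp_zero]

theorem subsingleton_ext_pi {n : ℕ} {ι : Type} [Fintype ι] [DecidableEq ι] {H : ι → Type u}
    [∀ i, AddCommGroup (H i)] [∀ i, Module R (H i)]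
    [∀ i, Subsingleton (Abelian.Ext.{u} (ModuleCat.of R (H i)) (ModuleCat.of R C) n)] :
    Subsingleton (Abelian.Ext.{u} (ModuleCat.of R (∀ i, H i)) (ModuleCat.of R C) n) := by
  refine subsingleton_of_forall_eq 0 fun y ↦ ?_
  have h1 : 𝟙 (ModuleCat.of R (∀ i, H i)) = ∑ i,
      ModuleCat.ofHom (LinearMap.proj (R := R) (φ := H) i) ≫
        ModuleCat.ofHom (LinearMap.single R H i) := by
    ext x
    simp [ModuleCat.hom_sum]
  rw [← Abelian.Ext.mk₀_id_comp y, h1, Abelian.Ext.mk₀_sum, Abelian.Ext.sum_comp]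
  refine Finset.sum_eq_zero fun i _ ↦ ?_
  rw [← Abelian.Ext.mk₀_comp_mk₀_assoc,
    Subsingleton.elim ((Abelian.Ext.mk₀ (ModuleCat.ofHom
      (LinearMap.single R H i))).comp y (zero_add n)) 0, Abelian.Ext.comp_zero]

/-- On Ext, `s` acts invertibly through `G` and as zero through `C`. -/
theorem subsingleton_ext_of_smul {n : ℕ} (s : R)
    (hG : Function.Bijective fun x : G ↦ s • x) (hC : ∀ c : C, s • c = 0) :
    Subsingleton (Abelian.Ext.{u} (ModuleCat.of R G) (ModuleCat.of R C) n) := by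
  refine subsingleton_of_forall_eq 0 fun y ↦ ?_
  let e : G ≃ₗ[R] G := LinearEquiv.ofBijective (LinearMap.lsmul R G s) hG
  have h1 : ModuleCat.ofHom e.symm.toLinearMap ≫ (s • 𝟙 (ModuleCat.of R G)) =
      𝟙 (ModuleCat.of R G) := by
    ext x
    exact e.apply_symm_apply x
  have h2 : s • 𝟙 (ModuleCat.of R C) = 0 := by
    ext x
    exact hC x
  have h3 : s • y = 0 := by
    rw [Abelian.Ext.smul_eq_comp_mk₀, h2, Abelian.Ext.mk₀_zero, Abelian.Ext.comp_zero]
  rw [← Abelian.Ext.mk₀_id_comp y, ← h1, ← Abelian.Ext.mk₀_comp_mk₀_assoc, Abelian.Ext.mk₀_smul,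
    Abelian.Ext.smul_comp, Abelian.Ext.mk₀_id_comp, h3, Abelian.Ext.comp_zero]

end Ext

/-! ### Purity and flatness. -/

section Purity

open TensorProduct

variable {R : Type u} [CommRing R] {K P G : Type u} [AddCommGroup K] [AddCommGroup P]
  [AddCommGroup G] [Module R K] [Module R P] [Module R G]

/-- This is the vanishing of Tor₁(G, X), as a diagram chase through a flat cover `Q` of `X`. -/
theorem Module.Flat.rTensor_injective_of_exact_of_exact [Module.Flat R G]
    {L Q X : Type u} [AddCommGroup L] [AddCommGroup Q] [AddCommGroup X] [Module R L] [Module R Q]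
    [Module R X] [Module.Flat R Q] {f : K →ₗ[R] P} {g : P →ₗ[R] G} {j : L →ₗ[R] Q} {q : Q →ₗ[R] X}
    (hf : Function.Injective f) (hfg : Function.Exact f g) (hg : Function.Surjective g)
    (hj : Function.Injective j) (hjq : Function.Exact j q) (hq : Function.Surjective q) :
    Function.Injective (f.rTensor X) := by
  refine (injective_iff_map_eq_zero _).mpr fun z hz ↦ ?_
  obtain ⟨z', rfl⟩ := q.lTensor_surjective K hq z
  have h1 : q.lTensor P (f.rTensor _ z') = 0 := by
    rw [← hz, ← LinearMap.comp_apply, ← LinearMap.comp_apply, LinearMap.lTensor_comp_rTensor,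
      LinearMap.rTensor_comp_lTensor]
  obtain ⟨w, hw⟩ := (_root_.lTensor_exact P hjq hq _).mp h1
  have h2 : j.lTensor G (g.rTensor _ w) = 0 := by
    rw [← LinearMap.comp_apply, LinearMap.lTensor_comp_rTensor, ← LinearMap.rTensor_comp_lTensor,
      LinearMap.comp_apply, hw]
    exact (_root_.rTensor_exact _ hfg hg).apply_apply_eq_zero z'
  have h3 : g.rTensor _ w = 0 :=
    (map_eq_zero_iff _ (lTensor_preserves_injective_linearMap (M := G) j hj)).mp h2
  obtain ⟨v, rfl⟩ := (_root_.rTensor_exact _ hfg hg _).mp h3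
  have h4 : j.lTensor K v = z' := by
    apply rTensor_preserves_injective_linearMap (M := Q) f hf
    rw [← hw, ← LinearMap.comp_apply, ← LinearMap.comp_apply, LinearMap.lTensor_comp_rTensor,
      LinearMap.rTensor_comp_lTensor]
  rw [← h4]
  exact (_root_.lTensor_exact K hjq hq).apply_apply_eq_zero v

theorem Module.Flat.rTensor_injective_of_exact [Module.Flat R G] {f : K →ₗ[R] P} {g : P →ₗ[R] G}
    (hf : Function.Injective f) (hfg : Function.Exact f g) (hg : Function.Surjective g)
    (X : Type u) [AddCommGroup X] [Module R X] : Function.Injective (f.rTensor X) :=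
  rTensor_injective_of_exact_of_exact hf hfg hg (Submodule.subtype_injective _)
    (LinearMap.exact_subtype_ker_map (Finsupp.linearCombination R (id : X → X)))
    (Finsupp.linearCombination_id_surjective R X)

theorem Module.Flat.of_rTensor_injective_of_exact [Module.Flat R P] {f : K →ₗ[R] P}
    {g : P →ₗ[R] G} (hfg : Function.Exact f g) (hg : Function.Surjective g)
    (h : ∀ (X : Type u) [AddCommGroup X] [Module R X], Function.Injective (f.rTensor X)) :
    Module.Flat R G := by
  refine Module.Flat.iff_lTensor_injective'.mpr fun I ↦ ?_
  have hI : Function.Exact I.subtype I.mkQ := LinearMap.exact_subtype_mkQ I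
  have hI' := I.mkQ_surjective
  refine (injective_iff_map_eq_zero _).mpr fun u hu ↦ ?_
  obtain ⟨v, rfl⟩ := g.rTensor_surjective _ hg u
  have h1 : g.rTensor _ (I.subtype.lTensor P v) = 0 := by
    rw [← hu, ← LinearMap.comp_apply, ← LinearMap.comp_apply, LinearMap.lTensor_comp_rTensor,
      LinearMap.rTensor_comp_lTensor]
  obtain ⟨w, hw⟩ := (_root_.rTensor_exact _ hfg hg _).mp h1
  have h2 : I.mkQ.lTensor K w = 0 := by
    apply h
    rw [map_zero, ← LinearMap.comp_apply, LinearMap.rTensor_comp_lTensor,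
      ← LinearMap.lTensor_comp_rTensor, LinearMap.comp_apply, hw]
    exact (_root_.lTensor_exact P hI hI').apply_apply_eq_zero v
  obtain ⟨w', rfl⟩ := (_root_.lTensor_exact K hI hI' _).mp h2
  have h3 : f.rTensor _ w' = v := by
    apply lTensor_preserves_injective_linearMap (M := P) I.subtype I.subtype_injective
    rw [← hw, ← LinearMap.comp_apply, ← LinearMap.comp_apply, LinearMap.lTensor_comp_rTensor,
      LinearMap.rTensor_comp_lTensor]
  rw [← h3]
  exact (_root_.rTensor_exact _ hfg hg).apply_apply_eq_zero w'

theorem Module.Flat.of_lTensor_injective [Module.Flat R P] {f : K →ₗ[R] P}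
    (h : ∀ (X : Type u) [AddCommGroup X] [Module R X], Function.Injective (f.lTensor X)) :
    Module.Flat R K := by
  refine Module.Flat.iff_rTensor_injective'.mpr fun I ↦ ?_
  have h1 : Function.Injective (f.lTensor R ∘ₗ I.subtype.rTensor K) := by
    rw [LinearMap.lTensor_comp_rTensor, ← LinearMap.rTensor_comp_lTensor, LinearMap.coe_comp]
    exact (rTensor_preserves_injective_linearMap (M := P) I.subtype I.subtype_injective).comp (h I)
  exact Function.Injective.of_comp h1

end Purity

theorem exists_free_presentation (R : Type u) [CommRing R] (G : Type u) [AddCommGroup G]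
    [Module R G] : ∃ (K Q : Type u) (_ : AddCommGroup K) (_ : AddCommGroup Q) (_ : Module R K)
      (_ : Module R Q) (_ : Module.Free R Q) (j : K →ₗ[R] Q) (q : Q →ₗ[R] G),
      Function.Injective j ∧ Function.Exact j q ∧ Function.Surjective q :=
  ⟨_, G →₀ R, _, _, _, _, inferInstance, _, _, Submodule.subtype_injective _,
    LinearMap.exact_subtype_ker_map (Finsupp.linearCombination R (id : G → G)),
    Finsupp.linearCombination_id_surjective R G⟩

/-! ### Weakly cotorsion and strongly flat modules, and base change. -/

section Classes

open TensorProduct StronglyFlat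

variable {R : Type u} [CommRing R] {S : Submonoid R}

theorem StronglyFlat.IsStronglyFlat.of_retract {G H : Type u} [AddCommGroup G] [Module R G]
    [AddCommGroup H] [Module R H] (hG : IsStronglyFlat S G) (i : H →ₗ[R] G) (r : G →ₗ[R] H)
    (h : r ∘ₗ i = LinearMap.id) : IsStronglyFlat S H := fun C _ _ hC ↦
  have := hG C hC
  subsingleton_ext_of_retract i r h

theorem StronglyFlat.IsStronglyFlat.pi {ι : Type} [Fintype ι] {G : ι → Type u}
    [∀ i, AddCommGroup (G i)] [∀ i, Module R (G i)] (hG : ∀ i, IsStronglyFlat S (G i)) :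
    IsStronglyFlat S (∀ i, G i) := fun C _ _ hC ↦ by
  classical
  have := fun i ↦ hG i C hC
  exact subsingleton_ext_pi

/-- By Hom-tensor adjunction, Ext¹(R_S, X⁺) is the character module of Tor₁(R_S, X), which is zero
as R_S is flat. -/
theorem StronglyFlat.isWeaklyCotorsion_characterModule (X : Type u) [AddCommGroup X]
    [Module R X] : IsWeaklyCotorsion S (CharacterModule X) := by
  have : Module.Flat R (Localization S) := IsLocalization.flat _ S
  obtain ⟨K, Q, _, _, _, _, _, j, q, hj, hjq, hq⟩ := exists_free_presentation R (Localization S)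
  refine subsingleton_ext_of_exists_extension hj hjq hq ?_
  exact rTensor_injective_iff_lcomp_surjective.mp (Module.Flat.rTensor_injective_of_exact
    hj hjq hq X)

theorem StronglyFlat.IsStronglyFlat.flat {G : Type u} [AddCommGroup G] [Module R G]
    (hG : IsStronglyFlat S G) : Module.Flat R G := by
  obtain ⟨K, Q, _, _, _, _, _, j, q, hj, hjq, hq⟩ := exists_free_presentation R G
  refine Module.Flat.of_rTensor_injective_of_exact hjq hq
    fun X _ _ ↦ rTensor_injective_iff_lcomp_surjective.mpr fun φ ↦ ?_
  have := hG _ (isWeaklyCotorsion_characterModule (S := S) X)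
  exact exists_extension_of_subsingleton_ext hj hjq hq φ

theorem StronglyFlat.IsStronglyFlat.projective_baseChange {A : Type u} [CommRing A] [Algebra R A]
    (hA : ∀ (D : Type u) [AddCommGroup D] [Module R D] [Module A D] [IsScalarTower R A D],
      IsWeaklyCotorsion S D)
    {G : Type u} [AddCommGroup G] [Module R G] (hG : IsStronglyFlat S G) :
    Module.Projective A (A ⊗[R] G) := by
  obtain ⟨K, Q, _, _, _, _, _, j, q, hj, hjq, hq⟩ := exists_free_presentation R G
  have := hG _ (hA (A ⊗[R] K))
  -- Extending the canonical map `K → A ⊗ K` to `Q` yields an `A`-linear retraction of `A ⊗ K → A ⊗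
  -- Q`, so the base-changed presentation splits.
  obtain ⟨ψ, hψ⟩ := exists_extension_of_subsingleton_ext hj hjq hq (TensorProduct.mk R A K 1)
  have h1 : ψ.liftBaseChange A ∘ₗ j.baseChange A = LinearMap.id := by
    ext x
    simpa using congr($hψ x)
  have h2 : Function.Exact (j.baseChange A) (q.baseChange A) := lTensor_exact A hjq hq
  have h3 : Function.Surjective (q.baseChange A) := q.lTensor_surjective A hq
  have h4 := h2.split_tfae'
  obtain ⟨-, l, hl⟩ := (h4.out 1 0 rfl rfl).mp ⟨h3, _, h1⟩
  exact .of_split l _ hl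

/-- Since `A ⊗ A ≅ A`, the presentation of `A` splits after base change; maps to an `A`-module
factor through the base change and hence extend. -/
theorem StronglyFlat.isWeaklyCotorsion_of_module_localization (D : Type u) [AddCommGroup D]
    [Module R D] [Module (Localization S) D] [IsScalarTower R (Localization S) D] :
    IsWeaklyCotorsion S D := by
  have : Module.Flat R (Localization S) := IsLocalization.flat _ S
  let A := Localization S
  obtain ⟨K, Q, _, _, _, _, _, j, q, hj, hjq, hq⟩ := exists_free_presentation R A
  have h1 : Function.Injective (j.baseChange A) :=
    Module.Flat.lTensor_preserves_injective_linearMap (M := A) j hj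
  have h2 : Function.Exact (j.baseChange A) (q.baseChange A) := lTensor_exact A hjq hq
  have h3 : Function.Surjective (q.baseChange A) := q.lTensor_surjective A hq
  have : Module.Projective A (A ⊗[R] A) := .of_equiv (IsLocalization.moduleLid S A A).symm
  have h4 := h2.split_tfae'
  obtain ⟨-, l, hl⟩ := (h4.out 0 1 rfl rfl).mp
    ⟨h1, Module.projective_lifting_property _ LinearMap.id h3⟩
  refine subsingleton_ext_of_exists_extension hj hjq hq fun φ ↦
    ⟨(φ.liftBaseChange A ∘ₗ l).restrictScalars R ∘ₗ TensorProduct.mk R A Q 1, ?_⟩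
  ext x
  have := congr($hl (1 ⊗ₜ x))
  simp only [LinearMap.comp_apply, LinearMap.baseChange_tmul] at this
  simp [this]

theorem StronglyFlat.isWeaklyCotorsion_of_smul_eq_zero {s : R} (hs : s ∈ S) (D : Type u)
    [AddCommGroup D] [Module R D] (hD : ∀ x : D, s • x = 0) : IsWeaklyCotorsion S D := by
  refine subsingleton_ext_of_smul s ?_ hD
  exact (Module.End.isUnit_iff _).mp
    (IsLocalizedModule.map_units (Algebra.linearMap R (Localization S)) ⟨s, hs⟩)

theorem StronglyFlat.isWeaklyCotorsion_of_module_quotient {s : R} (hs : s ∈ S) (D : Type u)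
    [AddCommGroup D] [Module R D] [Module (R ⧸ Ideal.span {s}) D]
    [IsScalarTower R (R ⧸ Ideal.span {s}) D] : IsWeaklyCotorsion S D := by
  refine isWeaklyCotorsion_of_smul_eq_zero hs D fun x ↦ ?_
  rw [← algebraMap_smul (R ⧸ Ideal.span {s}) s x, Ideal.Quotient.algebraMap_eq,
    Ideal.Quotient.eq_zero_iff_mem.mpr (Ideal.mem_span_singleton_self s), zero_smul]

theorem projective_baseChange_of_periodic {A : Type u} [CommRing A] [Algebra R A]
    {N P : Type u} [AddCommGroup N] [Module R N] [AddCommGroup P] [Module R P] [Module.Flat R N]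
    [Module.Projective A (A ⊗[R] P)] {f : N →ₗ[R] P} {g : P →ₗ[R] N}
    (hf : Function.Injective f) (hfg : Function.Exact f g) (hg : Function.Surjective g) :
    Module.Projective A (A ⊗[R] N) := by
  have h1 : Function.Injective (f.baseChange A) := (LinearMap.lTensor_inj_iff_rTensor_inj A f).mpr
    (Module.Flat.rTensor_injective_of_exact hf hfg hg A)
  have h2 : Function.Exact (f.baseChange A) (g.baseChange A) := lTensor_exact A hfg hg
  exact projective_of_periodic h1 h2 (g.lTensor_surjective A hg)

theorem StronglyFlat.SatisfiesOC.isStronglyFlat_of_periodic (hOC : SatisfiesOC S)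
    {N P : Type u} [AddCommGroup N] [Module R N] [AddCommGroup P] [Module R P]
    (hN : Module.Flat R N) (hP : IsStronglyFlat S P) {f : N →ₗ[R] P} {g : P →ₗ[R] N}
    (hf : Function.Injective f) (hfg : Function.Exact f g) (hg : Function.Surjective g) :
    IsStronglyFlat S N := by
  refine hOC.2 N hN ?_ fun s hs ↦ ?_
  · have := hP.projective_baseChange (A := Localization S)
      fun D ↦ isWeaklyCotorsion_of_module_localization D
    have := projective_baseChange_of_periodic (A := Localization S) hf hfg hg
    exact .of_equiv (LocalizedModule.equivTensorProduct S N).symm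
  · have := hP.projective_baseChange (A := R ⧸ Ideal.span {s})
      fun D ↦ isWeaklyCotorsion_of_module_quotient hs D
    have := projective_baseChange_of_periodic (A := R ⧸ Ideal.span {s}) hf hfg hg
    exact .of_equiv ((TensorProduct.quotTensorEquivQuotSMul N
      (Ideal.span {s})).extendScalarsOfSurjective Ideal.Quotient.mk_surjective)

end Classes

/-! ### Cycles of a pure exact sequence. -/

section ExactSequence

open TensorProduct StronglyFlat

variable {R : Type u} [CommRing R] {C : ℕ → Type u} [∀ i, AddCommGroup (C i)]
  [∀ i, Module R (C i)] {d : ∀ i, C i →ₗ[R] C (i + 1)} {n : ℕ}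

/-- The cycles are pure in `C (i + 1)`: a tensor killed there lifts to `X ⊗ C i`, where exactness
makes it a boundary, or zero if `i = 0`. -/
theorem StronglyFlat.IsPureExactSeq.flat_range (hd : IsPureExactSeq n d) {i : ℕ} (hi : i ≤ n)
    [Module.Flat R (C (i + 1))] : Module.Flat R (LinearMap.range (d i)) := by
  refine Module.Flat.of_lTensor_injective (f := (LinearMap.range (d i)).subtype) fun X _ _ ↦ ?_
  have hX := hd.tensor X
  have hcomp : (LinearMap.range (d i)).subtype ∘ₗ (d i).rangeRestrict = d i := rfl
  refine (injective_iff_map_eq_zero _).mpr fun u hu ↦ ?_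
  obtain ⟨z, rfl⟩ := (d i).rangeRestrict.lTensor_surjective X (d i).surjective_rangeRestrict u
  rw [← LinearMap.comp_apply, ← LinearMap.lTensor_comp, hcomp] at hu
  cases i with
  | zero =>
    rw [(map_eq_zero_iff _ hX.injective).mp hu, map_zero]
  | succ i =>
    obtain ⟨w, rfl⟩ := (hX.exact i hi _).mp hu
    have h0 : (d (i + 1)).rangeRestrict ∘ₗ d i = 0 := by
      ext x
      exact (hd.isExactSeq.exact i hi).apply_apply_eq_zero x
    rw [← LinearMap.comp_apply, ← LinearMap.lTensor_comp, h0, LinearMap.lTensor_zero,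
      LinearMap.zero_apply]

/-- The short exact sequences of cycles in an exact sequence `0 → C 0 → ⋯ → C (m + 2) → 0` whose
ends are identified add up to one short exact sequence with isomorphic ends. -/
theorem StronglyFlat.IsExactSeq.exists_periodic {m : ℕ}
    (hd : IsExactSeq (m + 1) d) (e : C (m + 2) ≃ₗ[R] C 0) :
    ∃ (f : (∀ i : Fin (m + 1), LinearMap.range (d i)) →ₗ[R] ∀ i : Fin (m + 1), C (i + 1))
      (g : (∀ i : Fin (m + 1), C (i + 1)) →ₗ[R] ∀ i : Fin (m + 1), LinearMap.range (d i)),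
      Function.Injective f ∧ Function.Exact f g ∧ Function.Surjective g := by
  let Z : Fin (m + 1) → Type u := fun i ↦ LinearMap.range (d i)
  let P : Type u := ∀ i : Fin (m + 1), C (i + 1)
  let f : (∀ i, Z i) →ₗ[R] P :=
    LinearMap.pi fun i ↦ (LinearMap.range (d i)).subtype ∘ₗ LinearMap.proj i
  -- The map `g` shifts the index cyclically: the last coordinate goes to `Z 0` through `C (m + 2) ≅
  -- C 0 ≅ Z 0`.
  let g₀ : P →ₗ[R] Z 0 := (d 0).rangeRestrict ∘ₗ e.toLinearMap ∘ₗ d (m + 1) ∘ₗ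
    (LinearMap.proj (Fin.last m) : P →ₗ[R] C (m + 1))
  let g₁ : ∀ j : Fin m, P →ₗ[R] Z j.succ := fun j ↦
    (d (j + 1)).rangeRestrict ∘ₗ (LinearMap.proj j.castSucc : P →ₗ[R] C (j + 1))
  let g : P →ₗ[R] ∀ i, Z i :=
    LinearMap.pi (Fin.cases (motive := fun i ↦ P →ₗ[R] Z i) g₀ g₁)
  have hg₀ : ∀ x, g x 0 = g₀ x := fun _ ↦ rfl
  have hg₁ : ∀ x j, g x (Fin.succ j) = g₁ j x := fun _ _ ↦ rfl
  refine ⟨f, g, fun x y h ↦ ?_, fun x ↦ ?_, fun z ↦ ?_⟩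
  · ext i : 1
    exact Subtype.ext (congrFun h i)
  · have h1 : g x = 0 ↔ ∀ i : Fin (m + 1), d (i + 1) (x i) = 0 := by
      -- To match the shift, the components of `g x` are split at the first index and the
      -- coordinates of `x` at the last.
      rw [funext_iff, Fin.forall_fin_succ, Fin.forall_fin_succ', and_comm]
      refine and_congr (forall_congr' fun j ↦ ?_) ?_
      · rw [hg₁]
        exact Subtype.ext_iff
      · rw [hg₀]
        refine Subtype.ext_iff.trans ?_
        change d 0 (e (d (m + 1) (x (Fin.last m)))) = 0 ↔ _
        rw [map_eq_zero_iff _ hd.injective, map_eq_zero_iff _ e.injective]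
        rfl
    rw [h1]
    constructor
    · intro h
      exact ⟨fun i ↦ ⟨x i, (hd.exact i i.2 _).mp (h i)⟩, rfl⟩
    · rintro ⟨z, rfl⟩ i
      exact (hd.exact i i.2 _).mpr (z i).2
  · obtain ⟨c, hc⟩ := (z 0).2
    obtain ⟨b, rfl⟩ := e.surjective c
    obtain ⟨w, rfl⟩ := hd.surjective b
    have hz : ∀ j : Fin m, ∃ y : C (j + 1), d (j + 1) y = (z j.succ).1 := fun j ↦ (z j.succ).2
    choose y hy using hz
    let x : P := Fin.lastCases (motive := fun i : Fin (m + 1) ↦ C (i + 1)) w y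
    have hx₀ : x (Fin.last m) = w := Fin.lastCases_last
    have hx₁ : ∀ j : Fin m, x j.castSucc = y j := fun j ↦ Fin.lastCases_castSucc j
    refine ⟨x, funext fun i ↦ ?_⟩
    induction i using Fin.cases with
    | zero =>
      rw [hg₀]
      refine Subtype.ext ?_
      change d 0 (e (d (m + 1) (x (Fin.last m)))) = _
      rw [hx₀]
      exact hc
    | succ j =>
      rw [hg₁]
      refine Subtype.ext ?_
      change d (j + 1) (x j.castSucc) = _
      rw [hx₁]
      exact hy j

end ExactSequence

theorem mainTheorem11 {R : Type u} [CommRing R] (S : Submonoid R)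
    (hOC : StronglyFlat.SatisfiesOC S) :
    (∀ (M G : Type u) [AddCommGroup M] [Module R M] [AddCommGroup G] [Module R G]
      (f : M →ₗ[R] G) (g : G →ₗ[R] M), StronglyFlat.IsPureShortExact f g →
      StronglyFlat.IsStronglyFlat S G → StronglyFlat.IsStronglyFlat S M) ∧
    (∀ (n : ℕ), 1 ≤ n → ∀ (M : Type u) [AddCommGroup M] [Module R M]
      (C : ℕ → Type u) [∀ i, AddCommGroup (C i)] [∀ i, Module R (C i)]
      (d : ∀ i, C i →ₗ[R] C (i + 1)), StronglyFlat.IsPureExactSeq n d →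
      Nonempty (M ≃ₗ[R] C 0) → Nonempty (C (n + 1) ≃ₗ[R] M) →
      (∀ i, 1 ≤ i → i ≤ n → StronglyFlat.IsStronglyFlat S (C i)) →
      StronglyFlat.IsStronglyFlat S M) := by
  refine ⟨fun M G _ _ _ _ f g hfg hG ↦ ?_, fun n hn M _ _ C _ _ d hd ⟨e₀⟩ ⟨e₁⟩ hC ↦ ?_⟩
  · have := hG.flat
    have hM : Module.Flat R M := .of_lTensor_injective fun X _ _ ↦ (hfg.tensor X).injective
    exact hOC.isStronglyFlat_of_periodic hM hG hfg.isShortExact.injective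
      hfg.isShortExact.exact hfg.isShortExact.surjective
  · obtain ⟨m, rfl⟩ := Nat.exists_eq_add_of_le' hn
    have hC' : ∀ i : Fin (m + 1), StronglyFlat.IsStronglyFlat S (C (i + 1)) :=
      fun i ↦ hC _ (Nat.le_add_left 1 i) i.2
    have hZ : ∀ i : Fin (m + 1), Module.Flat R (LinearMap.range (d i)) := fun i ↦
      have := (hC' i).flat
      hd.flat_range i.2.le
    have hN : Module.Flat R (∀ i : Fin (m + 1), LinearMap.range (d i)) :=
      .of_linearEquiv (DirectSum.linearEquivFunOnFintype R (Fin (m + 1))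
        fun i : Fin (m + 1) ↦ LinearMap.range (d i)).symm
    obtain ⟨f, g, hf, hfg, hg⟩ := hd.isExactSeq.exists_periodic (e₁.trans e₀)
    have hNS := hOC.isStronglyFlat_of_periodic hN (.pi hC') hf hfg hg
    let e : M ≃ₗ[R] LinearMap.range (d 0) :=
      e₀.trans (LinearEquiv.ofInjective (d 0) hd.isExactSeq.injective)
    -- `M` is the zeroth summand, since `d 0` is injective.
    refine hNS.of_retract
      (LinearMap.single R (fun i : Fin (m + 1) ↦ LinearMap.range (d i)) 0 ∘ₗ e.toLinearMap)
      (e.symm.toLinearMap ∘ₗ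
        LinearMap.proj (φ := fun i : Fin (m + 1) ↦ LinearMap.range (d i)) 0) ?_
    ext x
    have hx := Pi.single_eq_same (M := fun i : Fin (m + 1) ↦ LinearMap.range (d i)) 0 (e x)
    exact (congrArg e.symm hx).trans (e.symm_apply_apply x)
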